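/- **Theorem.** Let $n,d\ge 0$ be integers and identify operators on $(\mathbb C^d)^{\otimes n}$ with matrices indexed by multi-indices $i\in[d]^n$. For $\pi\in S_n$ let $P_\pi|i_1\dots i_n\rangle=|i_{\pi^{-1}(1)}\dots i_{\pi^{-1}(n)}\rangle$ and let $\Pi=\frac1{n!}\sum_{\pi\in S_n}P_\pi$ be the projection onto the symmetric subspace. Let $\operatorname{Herm}[\mathsf{DS}^{(n)}_d]$ be the set of Hermitian matrices $X$ with $\Pi X\Pi=X$ and $U^{\otimes n}X=XU^{\otimes n}$ for every diagonal unitary $U=\operatorname{diag}(e^{\mathrm i\theta_1},\dots,e^{\mathrm i\theta_d})$ (Hermitian mixtures of Dicke states). For $0\le k\le\lfloor n/2\rfloor$ let $$\mathsf{PPT}^{(n,k)}_d=\{X \text{ Hermitian}: \Pi X\Pi=X,\ X^{\Gamma_{[k]}}\succeq 0\},$$ where $\Gamma_{[k]}$ is the partial transposition of the first $k$ tensor factors (so $\mathsf{PPT}^{(n,0)}_d$ consists of the positive semidefinite $X$ with $\Pi X\Pi=X$). For a matrix $X$ let $Q[X]_i=\langle i|X|i\rangle$, $i\in[d]^n$,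 be its diagonal tensor. Finally let $\mathsf{Mom}^{(n,k)}_d$ be the set of real symmetric tensors $T=(T_i)_{i\in[d]^n}$ such that for every $0\le j\le k$ with $2j\le n$ and every $a\in[d]^{n-2j}$ the balanced flattening $$\big(T_{a_1\dots a_{n-2j}\,u_1\dots u_j\,v_1\dots v_j}\big)_{u,v\in[d]^j}$$ of the slice of $T$ of even order $2j$ at $a$ is positive semidefinite. Then for every $0\le k\le\lfloor n/2\rfloor$ and every $X\in\operatorname{Herm}[\mathsf{DS}^{(n)}_d]$, $$X\in\mathsf{PPT}^{(n,k)}_d\iff Q[X]\in\mathsf{Mom}^{(n,k)}_d .$$ In particular, for every $l\ge 0$ with $l+1\le\lfloor n/2\rfloor$, $$\mathsf{PPT}^{(n,l+1)}_d\cap\operatorname{Herm}[\mathsf{DS}^{(n)}_d]\subseteq\mathsf{PPT}^{(n,l)}_d\cap\operatorname{Herm}[\mathsf{DS}^{(n)}_d].$$ -/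

import Mathlib

noncomputable section

namespace DickePPT

open scoped ComplexOrder

/-- Operators on the `n`-fold tensor power of `ℂ ^ d`, written as matrices in the computational
basis `|i⟩ = |i₁ … iₙ⟩`, which is indexed by multi-indices `i : Fin n → Fin d`. -/
abbrev Op (n d : ℕ) := Matrix (Fin n → Fin d) (Fin n → Fin d) ℂ

/-- Tensors of order `n` over `R ^ d`, given by their components in the canonical basis. -/
abbrev Tensor (R : Type) (n d : ℕ) := (Fin n → Fin d) → R

/-- The permutation operator `P_π = ∑ i, |i_{π⁻¹(1)} … i_{π⁻¹(n)}⟩⟨i₁ … iₙ|`. -/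
def permOp (n d : ℕ) (π : Equiv.Perm (Fin n)) : Op n d :=
  Matrix.of fun a i => if a = fun m => i (π⁻¹ m) then 1 else 0

/-- The projection `(1 / n!) ∑ π, P_π` onto the symmetric subspace. -/
def symProj (n d : ℕ) : Op n d :=
  (n.factorial : ℂ)⁻¹ • ∑ π : Equiv.Perm (Fin n), permOp n d π

/-- The real linear space of Hermitian bosonic matrices, as a set. -/
def HermBosonic (n d : ℕ) : Set (Op n d) :=
  {X | X.IsHermitian ∧ symProj n d * X * symProj n d = X}

/-- The group of diagonal unitary `d × d` matrices `diag (exp (i θ₁), …, exp (i θ_d))`, as a set. -/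
def DiagUnitary (d : ℕ) : Set (Matrix (Fin d) (Fin d) ℂ) :=
  {U | ∃ θ : Fin d → ℝ, (∀ j, θ j ∈ Set.Ico 0 (2 * Real.pi)) ∧
    U = Matrix.diagonal fun j => Complex.exp (Complex.I * (θ j : ℂ))}

/-- The `n`-fold tensor power `U ⊗ ⋯ ⊗ U` of a `d × d` matrix. -/
def tensorPower (n : ℕ) {d : ℕ} (U : Matrix (Fin d) (Fin d) ℂ) : Op n d :=
  Matrix.of fun a b => ∏ m : Fin n, U (a m) (b m)

/-- The space `DS` of diagonally symmetric matrices: bosonic, and commuting with `U ⊗ ⋯ ⊗ U` for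
every diagonal unitary `U`. -/
def DS (n d : ℕ) : Set (Op n d) :=
  {X | symProj n d * X * symProj n d = X ∧
    ∀ U ∈ DiagUnitary d, tensorPower n U * X = X * tensorPower n U}

/-- The real space `Herm[DS]` of self-adjoint diagonally symmetric matrices (Hermitian mixtures of
Dicke states). -/
def HermDS (n d : ℕ) : Set (Op n d) :=
  {X | X ∈ DS n d ∧ X.IsHermitian}

/-- The partial transpose `X ^ Γ_I` on the tensor factors with positions in `I`. -/
def partialTranspose {n d : ℕ} (I : Finset (Fin n)) (X : Op n d) : Op n d :=
  Matrix.of fun a b =>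
    X (fun m => if m ∈ I then b m else a m) (fun m => if m ∈ I then a m else b m)

/-- The first `k` of the `n` parties. -/
def firstParties (n k : ℕ) : Finset (Fin n) :=
  Finset.univ.filter fun m => (m : ℕ) < k

/-- `PPT^{(n,k)}`: the Hermitian bosonic matrices whose partial transpose on the first `k` parties
is positive semidefinite.  For `k = 0` no factor is transposed, so these are the positive
semidefinite bosonic matrices. -/
def PPT (n d k : ℕ) : Set (Op n d) :=
  {X | X ∈ HermBosonic n d ∧ (partialTranspose (firstParties n k) X).PosSemidef}

/-- The diagonal tensor `Q[X]_i = ⟨i|X|i⟩`. -/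
def diagTensor {n d : ℕ} (X : Op n d) : Tensor ℂ n d :=
  fun i => X i i

/-- A real tensor, regarded as a complex one. -/
def Tensor.toComplex {n d : ℕ} (T : Tensor ℝ n d) : Tensor ℂ n d :=
  fun i => (T i : ℂ)

/-- A real tensor is symmetric if it is invariant under all permutations of its indices. -/
def IsSymmetricTensor {n d : ℕ} (T : Tensor ℝ n d) : Prop :=
  ∀ (σ : Equiv.Perm (Fin n)) (i : Fin n → Fin d), T i = T fun m => i (σ m)

/-- The slice `S_{j₁ … j_r} = T_{a₁ … a_m j₁ … j_r}` of order `r` of a tensor of order `m + r = n`,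
obtained by fixing `m` indices.  For symmetric tensors it does not matter which positions are
fixed; here they are the first `m`. -/
def slice {n d m r : ℕ} (h : n = m + r) (T : Tensor ℝ n d) (a : Fin m → Fin d) : Tensor ℝ r d :=
  fun j => T fun p => Fin.append a j (Fin.cast h p)

/-- The balanced flattening `M_{u v} = S_{u₁ … u_j v₁ … v_j}`, a `d ^ j × d ^ j` matrix, of a tensor
of even order `j + j`. -/
def flattening {d j : ℕ} (S : Tensor ℝ (j + j) d) :
    Matrix (Fin j → Fin d) (Fin j → Fin d) ℝ :=
  Matrix.of fun u v => S (Fin.append u v)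

/-- `SF^{(k)}[T]`: the family of the balanced flattenings of all slices of `T` of even order
`2 j ≤ 2 k`. -/
def SF {n d : ℕ} (k : ℕ) (T : Tensor ℝ n d) :
    Set (Σ j : ℕ, Matrix (Fin j → Fin d) (Fin j → Fin d) ℝ) :=
  {M | ∃ (m j : ℕ) (h : n = m + (j + j)) (a : Fin m → Fin d),
    j ≤ k ∧ M = ⟨j, flattening (slice h T a)⟩}

/-- The cone `Mom^{(n,k)}` of real symmetric tensors all of whose slice flattenings in `SF^{(k)}`
are positive semidefinite. -/
def Mom (n d k : ℕ) : Set (Tensor ℝ n d) :=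
  {T | IsSymmetricTensor T ∧ ∀ M ∈ SF k T, M.2.PosSemidef}

end DickePPT

end

/-!
By permutation symmetry on both sides, the entry `X a b` of a Hermitian mixture of Dicke states
depends only on the contents (multisets of letters) of `a` and `b`; by invariance under diagonal
unitaries it vanishes unless the two contents agree (`apply_eq_zero_of_content_ne`). So `X` is
determined by its diagonal, a real symmetric tensor `T`, and an entry of the partial transpose on
a set `I` of positions is `T` at the content `content I b + content Iᶜ a`, or `0` if this differs
from `content I a + content Iᶜ b`.

If the partial transpose is positive semidefinite, so is each flattening, as a submatrix up to
repetitions: the row index `u` of the flattening is placed both inside and outside of `I`, with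
the fixed indices of the slice in the remaining positions (`posSemidef_flattening`).

Conversely, the partial transpose is block diagonal, and the block of `x` is labelled by the signed
multiset `content I x - content Iᶜ x`. Within a block only the common part
`content I x ∩ content Iᶜ x` varies, and the block arises by restricting and repeating rows and
columns of the flattening of the slice at the multi-index made of the positive and negative parts
of the label (`posSemidef_partialTranspose`).

The inclusion of consecutive cones holds because a larger `k` only adds positivity conditions (`Mom_anti`).
-/

open scoped ComplexOrder

namespace DickePPT

/-! ### Contents of multi-indices -/

/-- The content of a multi-index `a` on the positions in `I`: the multiset of the values `a m`,
`m ∈ I`, counted with multiplicity. -/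
def content {α β : Type*} (I : Finset α) (a : α → β) : Multiset β :=
  I.val.map a

theorem content_congr {α β : Type*} {I : Finset α} {a b : α → β} (h : ∀ m ∈ I, a m = b m) :
    content I a = content I b :=
  Multiset.map_congr rfl h

@[simp]
theorem card_content {α β : Type*} (I : Finset α) (a : α → β) :
    Multiset.card (content I a) = I.card := by
  simp [content]

theorem content_add_content_compl {α β : Type*} [Fintype α] [DecidableEq α] (I : Finset α)
    (a : α → β) : content I a + content Iᶜ a = content Finset.univ a := by
  rw [content, content, content, ← Multiset.map_add, ← Finset.disjUnion_val _ _ disjoint_compl_right]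
  rw [Finset.disjUnion_eq_union, Finset.union_compl]

theorem content_comp_perm {α β : Type*} [Fintype α] (a : α → β) (σ : Equiv.Perm α) :
    content Finset.univ (a ∘ σ) = content Finset.univ a := by
  rw [content, content, ← Multiset.map_map, Multiset.map_univ_val_equiv]

theorem content_append {β : Type*} {m r : ℕ} (a : Fin m → β) (u : Fin r → β) :
    content Finset.univ (Fin.append a u) = content Finset.univ a + content Finset.univ u := by
  have key : ∀ {N : ℕ} (f : Fin N → β), content Finset.univ f = ∑ i, {f i} := fun f => by
    rw [content, ← Multiset.sum_map_singleton (Multiset.map f _), Multiset.map_map]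
    rfl
  simp [key, Fin.sum_univ_add]

/-- Two multi-indices with the same content are rearrangements of each other. -/
theorem exists_perm_of_content_eq {α β : Type*} [Fintype α] {a b : α → β}
    (h : content Finset.univ a = content Finset.univ b) :
    ∃ σ : Equiv.Perm α, a = b ∘ σ := by
  classical
  have e : ∀ c, Nonempty ({i // a i = c} ≃ {i // b i = c}) := fun c => by
    have key : ∀ f : α → β, Fintype.card {i // f i = c} = (content Finset.univ f).count c := by
      intro f
      rw [Fintype.card_subtype, content, Multiset.count_map, Finset.card, Finset.filter_val]
      simp only [eq_comm]
    exact ⟨Fintype.equivOfCardEq (by rw [key, key, h])⟩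
  refine ⟨Equiv.ofFiberEquiv fun c => (e c).some, ?_⟩
  funext i
  exact (Equiv.ofFiberEquiv_map _ i).symm

theorem exists_content_eq_of_nonempty {α β : Type*} [Nonempty β] (I : Finset α) :
    ∀ s : Multiset β, Multiset.card s = I.card → ∃ a : α → β, content I a = s := by
  classical
  induction I using Finset.induction_on with
  | empty =>
    intro s hs
    exact ⟨fun _ => Classical.arbitrary β, by simpa [content, eq_comm] using hs⟩
  | insert x I hx ih =>
    intro s hs
    rw [Finset.card_insert_of_notMem hx] at hs
    obtain ⟨b, hb⟩ := Multiset.card_pos_iff_exists_mem.1 (by omega : 0 < Multiset.card s)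
    obtain ⟨t, rfl⟩ := Multiset.exists_cons_of_mem hb
    obtain ⟨a, ha⟩ := ih t (by simpa using hs)
    refine ⟨Function.update a x b, ?_⟩
    rw [content, Finset.insert_val_of_notMem hx, Multiset.map_cons, Function.update_self]
    congr 1
    rw [← ha]
    exact content_congr fun m hm => Function.update_of_ne (ne_of_mem_of_not_mem hm hx) _ _

/-- The contents of a multi-index on a set of positions and on its complement can be prescribed
independently. -/
theorem exists_content_eq {α β : Type*} [Fintype α] [DecidableEq α] (I : Finset α)
    (s t : Multiset β) (hs : Multiset.card s = I.card) (ht : Multiset.card t = Iᶜ.card) :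
    ∃ a : α → β, content I a = s ∧ content Iᶜ a = t := by
  rcases isEmpty_or_nonempty β with hβ | hβ
  · have h0 : ∀ s : Multiset β, s = 0 := fun s => Multiset.eq_zero_of_forall_notMem fun x => hβ.elim x
    have h1 : I.card + Iᶜ.card = 0 := by rw [← hs, ← ht, h0 s, h0 t]; rfl
    rw [Finset.card_add_card_compl, Fintype.card_eq_zero_iff] at h1
    exact ⟨fun x => h1.elim x, (h0 _).trans (h0 _).symm, (h0 _).trans (h0 _).symm⟩
  · obtain ⟨a, ha⟩ := exists_content_eq_of_nonempty I s hs
    obtain ⟨b, hb⟩ := exists_content_eq_of_nonempty Iᶜ t ht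
    refine ⟨fun m => if m ∈ I then a m else b m, ?_, ?_⟩
    · rw [← ha]
      exact content_congr fun m hm => if_pos hm
    · rw [← hb]
      exact content_congr fun m hm => if_neg (Finset.mem_compl.1 hm)

theorem exists_content_univ_eq {β : Type*} (j : ℕ) (s : Multiset β)
    (hs : Multiset.card s = j) : ∃ u : Fin j → β, content Finset.univ u = s := by
  obtain ⟨u, hu, -⟩ := exists_content_eq (Finset.univ : Finset (Fin j)) s 0 (by simpa) (by simp)
  exact ⟨u, hu⟩

/-- The content of the multi-index obtained from `a` by taking the entries of `b` on `I`, as a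
partial transposition on `I` does to row and column indices. -/
theorem content_ite {α β : Type*} [Fintype α] [DecidableEq α] (I : Finset α) (a b : α → β) :
    content Finset.univ (fun m => if m ∈ I then b m else a m) =
      content I b + content Iᶜ a := by
  rw [← content_add_content_compl I]
  congr 1
  · exact content_congr fun m hm => if_pos hm
  · exact content_congr fun m hm => if_neg (Finset.mem_compl.1 hm)

/-! ### Positive semidefinite matrices -/

/-- A real matrix is positive semidefinite over `ℝ` if and only if it is so over `ℂ`. -/
theorem posSemidef_map_ofReal {ι : Type*} [Finite ι] {A : Matrix ι ι ℝ} :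
    (A.map Complex.ofReal).PosSemidef ↔ A.PosSemidef := by
  have := Fintype.ofFinite ι
  constructor
  · intro h
    refine Matrix.PosSemidef.of_dotProduct_mulVec_nonneg ?_ fun x => ?_
    · ext i j
      have := congrFun (congrFun h.1 i) j
      simpa using this
    · have := h.dotProduct_mulVec_nonneg fun i => (x i : ℂ)
      have e : star (fun i => (x i : ℂ)) ⬝ᵥ (A.map Complex.ofReal).mulVec (fun i => (x i : ℂ)) =
          ((star x ⬝ᵥ A.mulVec x : ℝ) : ℂ) := by
        simp [dotProduct, Matrix.mulVec]
      rw [e] at this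
      exact_mod_cast this
  · intro h
    obtain ⟨m, v, rfl⟩ := Matrix.posSemidef_iff_eq_sum_vecMulVec.1 h
    refine Matrix.posSemidef_iff_eq_sum_vecMulVec.2 ⟨m, fun i x => (v i x : ℂ), ?_⟩
    ext x y
    simp [Matrix.sum_apply, Matrix.vecMulVec_apply]

/-- A matrix that is block diagonal with respect to a labelling `key` of the indices is positive
semidefinite as soon as each of its blocks is the restriction of a positive semidefinite matrix. -/
theorem posSemidef_of_blocks {ι κ : Type*} [Fintype ι] {M : Matrix ι ι ℂ} (key : ι → κ)
    (hoff : ∀ x y, key x ≠ key y → M x y = 0)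
    (hblock : ∀ z, ∃ N : Matrix ι ι ℂ, N.PosSemidef ∧
      ∀ x y, key x = key z → key y = key z → M x y = N x y) : M.PosSemidef := by
  classical
  have hblock' : ∀ c, ∃ N : Matrix ι ι ℂ, N.PosSemidef ∧
      ∀ x y, key x = c → key y = c → M x y = N x y := fun c => by
    by_cases hc : ∃ z, key z = c
    · obtain ⟨z, rfl⟩ := hc
      exact hblock z
    · exact ⟨0, Matrix.PosSemidef.zero, fun x _ hx => absurd ⟨x, hx⟩ hc⟩
  choose N hN hMN using hblock'
  -- `M` is the sum of its blocks, each cut out of some `N c` by the coordinate projection `D c`.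
  let D : κ → Matrix ι ι ℂ := fun c => Matrix.diagonal fun x => if key x = c then 1 else 0
  have hM : M = ∑ c ∈ Finset.univ.image key, (D c).conjTranspose * N c * D c := by
    ext x y
    rw [Matrix.sum_apply, Finset.sum_eq_single (key x)]
    · by_cases h : key y = key x
      · simp [D, Matrix.diagonal_conjTranspose, Matrix.diagonal_mul, Matrix.mul_diagonal, h,
          hMN (key x) x y rfl h]
      · simp [D, Matrix.mul_diagonal, h, hoff x y (Ne.symm h)]
    · intro c _ hc
      simp [D, Matrix.diagonal_conjTranspose, Matrix.diagonal_mul, Matrix.mul_diagonal, Ne.symm hc]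
    · simp
  rw [hM]
  exact Matrix.posSemidef_sum _ fun c _ => (hN _).conjTranspose_mul_mul_same _

/-! ### Diagonally symmetric matrices are determined by their diagonal -/

theorem permOp_mul_apply {n d : ℕ} (π : Equiv.Perm (Fin n)) (X : Op n d) (a b : Fin n → Fin d) :
    (permOp n d π * X) a b = X (a ∘ π) b := by
  have h : ∀ i : Fin n → Fin d, (a = fun m => i (π⁻¹ m)) ↔ i = a ∘ π := by
    intro i
    constructor
    · rintro rfl
      funext m
      simp
    · rintro rfl
      funext m
      simp
  simp only [Matrix.mul_apply, permOp, Matrix.of_apply, h, ite_mul, one_mul, zero_mul,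
    Finset.sum_ite_eq', Finset.mem_univ, if_true]

theorem permOp_mul_symProj {n d : ℕ} (π : Equiv.Perm (Fin n)) :
    permOp n d π * symProj n d = symProj n d := by
  have hmul : ∀ σ, permOp n d π * permOp n d σ = permOp n d (π * σ) := by
    intro σ
    ext a i
    rw [permOp_mul_apply]
    simp only [permOp, Matrix.of_apply]
    congr 1
    rw [eq_iff_iff]
    constructor
    · intro h
      funext m
      simpa using congrFun h (π⁻¹ m)
    · intro h
      funext m
      simpa using congrFun h (π m)
  rw [symProj, Matrix.mul_smul, Matrix.mul_sum]
  simp only [hmul]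
  congr 1
  exact Fintype.sum_equiv (Equiv.mulLeft π) _ _ fun σ => rfl

theorem apply_comp_perm_left {n d : ℕ} {X : Op n d} (hX : X ∈ HermDS n d)
    (σ : Equiv.Perm (Fin n)) (a b : Fin n → Fin d) : X (a ∘ σ) b = X a b := by
  rw [← permOp_mul_apply σ X a b]
  conv_lhs => rw [← hX.1.1, ← Matrix.mul_assoc, ← Matrix.mul_assoc, permOp_mul_symProj, hX.1.1]

theorem apply_comp_perm_right {n d : ℕ} {X : Op n d} (hX : X ∈ HermDS n d)
    (σ : Equiv.Perm (Fin n)) (a b : Fin n → Fin d) : X a (b ∘ σ) = X a b := by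
  rw [← hX.2.apply, apply_comp_perm_left hX, hX.2.apply]

/-- Testing against the diagonal unitary with a single phase `exp i` at `c` compares
`exp (i p)` with `exp (i q)`, where `p` and `q` count the occurrences of `c` in `a` and in `b`;
these differ for `p ≠ q` because `π` is irrational. -/
theorem apply_eq_zero_of_content_ne {n d : ℕ} {X : Op n d} (hX : X ∈ HermDS n d)
    {a b : Fin n → Fin d} (h : content Finset.univ a ≠ content Finset.univ b) : X a b = 0 := by
  by_contra hne
  refine h (Multiset.ext.2 fun c => ?_)
  let θ : Fin d → ℝ := fun j => if c = j then 1 else 0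
  let U : Matrix (Fin d) (Fin d) ℂ :=
    Matrix.diagonal fun j => Complex.exp (Complex.I * (θ j : ℂ))
  have hU : U ∈ DiagUnitary d := by
    refine ⟨θ, fun j => ?_, rfl⟩
    have := Real.pi_gt_three
    simp only [θ]
    split_ifs <;> constructor <;> linarith
  have hpow : tensorPower n U = Matrix.diagonal fun x : Fin n → Fin d =>
      Complex.exp (Complex.I * ((content Finset.univ x).count c : ℂ)) := by
    ext x y
    by_cases hxy : x = y
    · subst hxy
      simp only [tensorPower, Matrix.of_apply, Matrix.diagonal_apply_eq, U]
      rw [← Complex.exp_sum, ← Finset.mul_sum]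
      congr 2
      rw [content, Multiset.count_map]
      simp only [θ, apply_ite Complex.ofReal, Complex.ofReal_one, Complex.ofReal_zero]
      rw [Finset.sum_boole, Finset.card, Finset.filter_val]
    · obtain ⟨m, hm⟩ := Function.ne_iff.1 hxy
      rw [Matrix.diagonal_apply_ne _ hxy]
      exact Finset.prod_eq_zero (Finset.mem_univ m) (Matrix.diagonal_apply_ne _ hm)
  have hcomm := congrFun (congrFun (hX.1.2 U hU) a) b
  rw [hpow, Matrix.diagonal_mul, Matrix.mul_diagonal, mul_comm (X a b)] at hcomm
  obtain ⟨z, hz⟩ := Complex.exp_eq_exp_iff_exists_int.1 (mul_right_cancel₀ hne hcomm)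
  set p := (content Finset.univ a).count c
  set q := (content Finset.univ b).count c
  have hz' : (p : ℝ) = q + z * (2 * Real.pi) := by
    have : (p : ℂ) = q + z * (2 * Real.pi) :=
      mul_left_cancel₀ Complex.I_ne_zero (by rw [hz]; ring)
    exact_mod_cast this
  by_cases hz0 : z = 0
  · simpa [hz0] using hz'
  -- Otherwise `π` would equal the rational number `(p - q) / (2 z)`.
  · refine absurd irrational_pi (not_not.2 ⟨((p : ℚ) - q) / (2 * z), ?_⟩)
    have : (z : ℝ) ≠ 0 := by exact_mod_cast hz0
    push_cast
    rw [hz']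
    field_simp
    ring

theorem apply_eq_diag_of_content_eq {n d : ℕ} {X : Op n d} (hX : X ∈ HermDS n d)
    {a b : Fin n → Fin d} (h : content Finset.univ a = content Finset.univ b) :
    X a b = X a a := by
  obtain ⟨σ, rfl⟩ := exists_perm_of_content_eq h.symm
  exact apply_comp_perm_right hX σ a a

/-- The real parts of the diagonal entries of `X`. For Hermitian `X` this is its diagonal tensor. -/
def realDiag {n d : ℕ} (X : Op n d) : Tensor ℝ n d :=
  fun i => (X i i).re

theorem ofReal_realDiag {n d : ℕ} {X : Op n d} (hX : X ∈ HermDS n d) (i : Fin n → Fin d) :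
    (realDiag X i : ℂ) = X i i :=
  hX.2.coe_re_apply_self i

theorem isSymmetricTensor_realDiag {n d : ℕ} {X : Op n d} (hX : X ∈ HermDS n d) :
    IsSymmetricTensor (realDiag X) := by
  intro σ i
  change (X i i).re = (X (i ∘ σ) (i ∘ σ)).re
  rw [apply_comp_perm_left hX, apply_comp_perm_right hX]

theorem IsSymmetricTensor.apply_eq {n d : ℕ} {T : Tensor ℝ n d} (hT : IsSymmetricTensor T)
    {a b : Fin n → Fin d} (h : content Finset.univ a = content Finset.univ b) : T a = T b := by
  obtain ⟨σ, rfl⟩ := exists_perm_of_content_eq h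
  exact (hT σ b).symm

theorem diagTensor_mem_image_iff {n d : ℕ} {X : Op n d} (hX : X ∈ HermDS n d)
    (S : Set (Tensor ℝ n d)) :
    diagTensor X ∈ Tensor.toComplex '' S ↔ realDiag X ∈ S := by
  have h : Tensor.toComplex (realDiag X) = diagTensor X := funext fun i => ofReal_realDiag hX i
  constructor
  · rintro ⟨T, hT, hTX⟩
    have : realDiag X = T := by
      funext i
      exact Complex.ofReal_injective (congrFun (h.trans hTX.symm) i)
    rwa [this]
  · exact fun hT => ⟨_, hT, h⟩

/-! ### The partial transpose and the flattenings -/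

theorem partialTranspose_apply {n d : ℕ} {X : Op n d} (hX : X ∈ HermDS n d) (I : Finset (Fin n))
    {a b i : Fin n → Fin d}
    (hab : content I b + content Iᶜ a = content I a + content Iᶜ b)
    (hi : content Finset.univ i = content I b + content Iᶜ a) :
    partialTranspose I X a b = realDiag X i := by
  have h1 := content_ite I a b
  have h2 := content_ite I b a
  rw [isSymmetricTensor_realDiag hX |>.apply_eq (hi.trans h1.symm), ofReal_realDiag hX]
  exact apply_eq_diag_of_content_eq hX (h1.trans (hab.trans h2.symm))

theorem partialTranspose_apply_eq_zero {n d : ℕ} {X : Op n d} (hX : X ∈ HermDS n d)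
    (I : Finset (Fin n)) {a b : Fin n → Fin d}
    (hab : content I b + content Iᶜ a ≠ content I a + content Iᶜ b) :
    partialTranspose I X a b = 0 := by
  refine apply_eq_zero_of_content_ne hX ?_
  rwa [content_ite I a b, content_ite I b a]

/-- The entries of a slice flattening, in terms of contents. -/
theorem flattening_slice_apply {n d m j : ℕ} (h : n = m + (j + j)) (T : Tensor ℝ n d)
    (a : Fin m → Fin d) (u v : Fin j → Fin d) :
    ∃ i : Fin n → Fin d, flattening (slice h T a) u v = T i ∧
      content Finset.univ i =
        content Finset.univ a + (content Finset.univ u + content Finset.univ v) := by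
  subst h
  exact ⟨_, rfl, by simp only [Fin.cast_refl, id, content_append]⟩

/-- Each flattening is a submatrix of the partial transpose: the multi-index `u` of a row is
placed both inside and outside of `I`, and the fixed indices `a` fill the remaining positions. -/
theorem posSemidef_flattening {n d : ℕ} {X : Op n d} (hX : X ∈ HermDS n d) {I : Finset (Fin n)}
    (hI : I.card ≤ n / 2) (hpos : (partialTranspose I X).PosSemidef) {m j : ℕ}
    (h : n = m + (j + j)) (hj : j ≤ I.card) (a : Fin m → Fin d) :
    (flattening (slice h (realDiag X) a)).PosSemidef := by
  have hcompl : Iᶜ.card = n - I.card := by rw [Finset.card_compl, Fintype.card_fin]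
  obtain ⟨s, hs⟩ : ∃ s, s ∈ Multiset.powersetCard (I.card - j) (content Finset.univ a) := by
    rw [← Multiset.card_pos_iff_exists_mem, Multiset.card_powersetCard, card_content,
      Finset.card_univ, Fintype.card_fin]
    exact Nat.choose_pos (by omega)
  obtain ⟨hs, hcard⟩ := Multiset.mem_powersetCard.1 hs
  obtain ⟨t, ht⟩ := Multiset.le_iff_exists_add.1 hs
  -- `s` fills up the positions in `I` and `t` those outside of `I`.
  have hst : Multiset.card s + Multiset.card t = m := by
    rw [← Multiset.card_add, ← ht, card_content, Finset.card_univ, Fintype.card_fin]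
  have hrow : ∀ u : Fin j → Fin d, ∃ x : Fin n → Fin d,
      content I x = s + content Finset.univ u ∧ content Iᶜ x = t + content Finset.univ u :=
    fun u => exists_content_eq I _ _ (by simp; omega) (by simp; omega)
  choose x hx hx' using hrow
  have hsub : (flattening (slice h (realDiag X) a)).map Complex.ofReal =
      (partialTranspose I X).submatrix x x := by
    ext u v
    obtain ⟨i, hi, hc⟩ := flattening_slice_apply h (realDiag X) a u v
    rw [Matrix.map_apply, hi, Matrix.submatrix_apply, partialTranspose_apply hX]
    · rw [hx, hx, hx', hx']
      abel
    · rw [hc, ht, hx, hx']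
      abel
  rw [← posSemidef_map_ofReal, hsub]
  exact hpos.submatrix x

/-- For multisets, `q + r = p + s` says that `p` and `r` differ from `q` and `s` respectively by
the same signed multiset. -/
theorem add_eq_add_iff_sub_eq_sub {β : Type*} [DecidableEq β] (p q r s : Multiset β) :
    q + r = p + s ↔ p - r = q - s ∧ r - p = s - q := by
  simp only [Multiset.ext, Multiset.count_add, Multiset.count_sub]
  constructor
  · intro h
    constructor <;> intro c <;> have := h c <;> omega
  · rintro ⟨h1, h2⟩ c
    have := h1 c
    have := h2 c
    omega

/-- The partial transpose is block diagonal, the block of a row `x` being labelled by the signed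
multiset `content I x - content Iᶜ x`, encoded as its negative and positive parts. Up to repeated
rows, each block is a part of the flattening of the slice at the multi-index made of both parts,
a row `x` corresponding to the common part `content I x ∩ content Iᶜ x`. -/
theorem posSemidef_partialTranspose {n d : ℕ} {X : Op n d} (hX : X ∈ HermDS n d)
    {I : Finset (Fin n)} (hI : I.card ≤ n / 2) {k : ℕ} (hk : I.card ≤ k)
    (hmom : realDiag X ∈ Mom n d k) :
    (partialTranspose I X).PosSemidef := by
  have hcompl : Iᶜ.card = n - I.card := by rw [Finset.card_compl, Fintype.card_fin]
  refine posSemidef_of_blocks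
    (fun x => (content I x - content Iᶜ x, content Iᶜ x - content I x)) (fun x y hxy => ?_)
    fun z => ?_
  · refine partialTranspose_apply_eq_zero hX I fun h => hxy ?_
    have := (add_eq_add_iff_sub_eq_sub _ _ _ _).1 h
    exact Prod.ext this.1 this.2
  · have hsplit : ∀ x : Fin n → Fin d, content I x =
        (content I x - content Iᶜ x) + content I x ∩ content Iᶜ x ∧
        content Iᶜ x = (content Iᶜ x - content I x) + content I x ∩ content Iᶜ x := fun x => by
      simp only [Multiset.ext, Multiset.count_add, Multiset.count_sub, Multiset.count_inter]
      constructor <;> intro c <;> omega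
    obtain ⟨j, hj⟩ : ∃ j, j = Multiset.card (content I z ∩ content Iᶜ z) := ⟨_, rfl⟩
    obtain ⟨m, hm⟩ : ∃ m, m = Multiset.card
      ((content I z - content Iᶜ z) + (content Iᶜ z - content I z)) := ⟨_, rfl⟩
    have hc1 := congrArg Multiset.card (hsplit z).1
    have hc2 := congrArg Multiset.card (hsplit z).2
    rw [Multiset.card_add] at hm
    rw [Multiset.card_add, card_content, ← hj] at hc1 hc2
    have h : n = m + (j + j) := by omega
    obtain ⟨a, ha⟩ := exists_content_univ_eq m _
      ((Multiset.card_add _ _).trans hm.symm)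
    -- Outside of the block of `z` the choice of `u` is irrelevant; the tuple belonging to `z` only
    -- serves to show that one exists.
    have hrow : ∀ x : Fin n → Fin d, ∃ u : Fin j → Fin d,
        (content I x - content Iᶜ x, content Iᶜ x - content I x) =
          (content I z - content Iᶜ z, content Iᶜ z - content I z) →
        content Finset.univ u = content I x ∩ content Iᶜ x := fun x => by
      by_cases hxz : (content I x - content Iᶜ x, content Iᶜ x - content I x) =
          (content I z - content Iᶜ z, content Iᶜ z - content I z)
      · have hc := congrArg Multiset.card (hsplit x).1
        have hx1 : content I x - content Iᶜ x = content I z - content Iᶜ z := congrArg Prod.fst hxz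
        rw [Multiset.card_add, card_content, hx1] at hc
        obtain ⟨u, hu⟩ := exists_content_univ_eq j (content I x ∩ content Iᶜ x) (by omega)
        exact ⟨u, fun _ => hu⟩
      · obtain ⟨u, -⟩ := exists_content_univ_eq j _ hj.symm
        exact ⟨u, fun h => absurd h hxz⟩
    choose u hu using hrow
    have hF : (flattening (slice h (realDiag X) a)).PosSemidef := hmom.2 _ ⟨m, j, h, a, by omega, rfl⟩
    refine ⟨_, (posSemidef_map_ofReal.2 hF).submatrix u, fun x y hx hy => ?_⟩
    obtain ⟨i, hi, hc⟩ := flattening_slice_apply h (realDiag X) a (u x) (u y)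
    rw [Matrix.submatrix_apply, Matrix.map_apply, hi]
    have hxy := Prod.ext_iff.1 (hx.trans hy.symm)
    have hx2 : content Iᶜ x - content I x = content Iᶜ z - content I z := congrArg Prod.snd hx
    have hy1 : content I y - content Iᶜ y = content I z - content Iᶜ z := congrArg Prod.fst hy
    refine partialTranspose_apply hX I ((add_eq_add_iff_sub_eq_sub _ _ _ _).2 hxy) ?_
    have hy' := (hsplit y).1
    have hx' := (hsplit x).2
    rw [hy1] at hy'
    rw [hx2] at hx'
    rw [hc, hu x hx, hu y hy, ha]
    refine Eq.trans ?_ (congrArg₂ (· + ·) hy' hx').symm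
    rw [add_comm (content I x ∩ content Iᶜ x), add_add_add_comm]

/-! ### The moment cones -/

theorem card_firstParties {n k : ℕ} (hk : k ≤ n) : (firstParties n k).card = k := by
  rw [firstParties, Fin.card_filter_val_lt, min_eq_right hk]

theorem mem_PPT_iff_realDiag_mem_Mom {n d k : ℕ} (hk : k ≤ n / 2) {X : Op n d}
    (hX : X ∈ HermDS n d) : X ∈ PPT n d k ↔ realDiag X ∈ Mom n d k := by
  have hcard : (firstParties n k).card = k := card_firstParties (by omega)
  constructor
  · rintro ⟨-, hpos⟩
    refine ⟨isSymmetricTensor_realDiag hX, ?_⟩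
    rintro _ ⟨m, j, h, a, hj, rfl⟩
    exact posSemidef_flattening hX (by omega) hpos h (by omega) a
  · intro hmom
    exact ⟨⟨hX.2, hX.1.1⟩, posSemidef_partialTranspose hX (by omega) hcard.le hmom⟩

theorem Mom_anti {n d k l : ℕ} (h : k ≤ l) : Mom n d l ⊆ Mom n d k := by
  rintro T ⟨hT, hpos⟩
  refine ⟨hT, ?_⟩
  rintro _ ⟨m, j, hn, a, hj, rfl⟩
  exact hpos _ ⟨m, j, hn, a, hj.trans h, rfl⟩

end DickePPT

theorem mainTheorem1 (n d : ℕ) :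
    (∀ k : ℕ, k ≤ n / 2 → ∀ X ∈ DickePPT.HermDS n d,
      (X ∈ DickePPT.PPT n d k ↔
        DickePPT.diagTensor X ∈ DickePPT.Tensor.toComplex '' DickePPT.Mom n d k)) ∧
    (∀ l : ℕ, l + 1 ≤ n / 2 →
      DickePPT.PPT n d (l + 1) ∩ DickePPT.HermDS n d ⊆
        DickePPT.PPT n d l ∩ DickePPT.HermDS n d) := by
  refine ⟨fun k hk X hX => ?_, ?_⟩
  · rw [DickePPT.diagTensor_mem_image_iff hX, DickePPT.mem_PPT_iff_realDiag_mem_Mom hk hX]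
  · rintro l hl X ⟨hP, hX⟩
    rw [DickePPT.mem_PPT_iff_realDiag_mem_Mom hl hX] at hP
    refine ⟨?_, hX⟩
    rw [DickePPT.mem_PPT_iff_realDiag_mem_Mom (by omega) hX]
    exact DickePPT.Mom_anti l.le_succ hP
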